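/- **Relaxed Scalable Nyquist Stability Criterion.** *Network.* Consider a lossless network with $n\ge 2$ buses, voltage magnitudes $V_i>0$, line susceptances $b_{il}=b_{li}\ge 0$ and operating-point phase angles $\delta^*_i$. Let $$\mathcal L_{ij}=\frac{\partial}{\partial\delta_j}\sum_{l=1}^n V_iV_lb_{il}\sin(\delta_i-\delta_l)\Big|_{\delta=\delta^*},$$ and assume that $\mathcal L$ is the Laplacian matrix of a connected network: $\mathcal L_{ij}\le 0$ for $i\ne j$, and the graph joining $i\neq j$ whenever $\mathcal L_{ij}\ne0$ is connected. Put $\Gamma=\mathrm{diag}(\gamma_1,\dots,\gamma_n)$ with $\gamma_i=2\mathcal L_{ii}$, and $\mathcal L'=\Gamma^{-1/2}\mathcal L\,\Gamma^{-1/2}$. *Agents.* Let $M_i\ge 0$ and let $F_i,R_i$ be meromorphic on $\mathbb C$ (for example rational, possibly with time delays) such that $s^2M_i+sF_i(s)+R_i(s)\not\equiv 0$. Let $g_i(s)=\dfrac1{s^2M_i+sF_i(s)+R_i(s)}$, regarded as a meromorphic function with its removable singularities removed, and $\mathcal G'(s)=\Gamma^{1/2}\,\mathrm{diag}(g_1(s),\dots,g_n(s))\,\Gamma^{1/2}$.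 *Contour.* Let $r>0$. The contour $\mathcal D_r$ runs up the imaginary axis, with a half-disc indentation of radius $r$ into the right half-plane at the origin and possibly finitely many further half-disc indentations into the right half-plane centred on the imaginary axis, and is closed by an infinite semicircle in the right half-plane, that is, by the semicircle of radius $\rho$ about the origin for all sufficiently large $\rho$. The inside of $\mathcal D_r$ is the open right half-plane without the (closed) indentations. Assume that the indented imaginary axis passes through no pole of $\mathcal G'$. *Field of values.* For $A\in\mathbb C^{n\times n}$ let $\mathcal F(A)=\{v^{\mathsf H}Av: v^{\mathsf H}v=1\}$. Given $\alpha$, the moving set $\alpha\mathcal F(\mathcal G'(s))$ *encircles* $-1$ as $s$ goes around a closed contour if some closed continuous curve $z(s)\in\alpha\mathcal F(\mathcal G'(s))$ that avoids $-1$ has nonzero winding number around $-1$. *Modes.* A mode of the closed loop with return ratio $-Q(s)$ is a root of $\phi_{cl}=\phi_{ol}\det(I+Q)$, where $\phi_{ol}$ is the Smith–McMillan pole polynomial of $Q$ (for meromorphic $Q$, it is taken locally: its multiplicity at $s$ is the largest pole order at $s$ of a minor of $Q$, the empty minor $1$ included). Write the eigenvalue decomposition of $\mathcal L'$, with the average mode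 (the kernel) split off, as $\mathcal L'=\hat{\mathcal U}\hat X\hat{\mathcal U}^{\mathsf T}$, where the columns of $\hat{\mathcal U}$ are orthonormal eigenvectors for the nonzero eigenvalues and $\hat X$ is the diagonal matrix of these eigenvalues. The closed loop with return ratio $-\mathcal L'\mathcal G'(s)$ has *stable interarea modes* inside $\mathcal D_r$ if the closed loop with return ratio $-\hat{\mathcal U}^{\mathsf T}\mathcal G'(s)\hat{\mathcal U}\hat X$ has no mode inside $\mathcal D_r$ and the transfer matrix $\mathcal L'(I+\mathcal G'(s)\mathcal L')^{-1}$ has no pole inside $\mathcal D_r$. *Claim.* Assume that $\mathcal G'(s)$ has no poles inside $\mathcal D_r$, and that for every $\alpha\in(0,1]$ the field of values $\alpha\,\mathcal F(\mathcal G'(s))$ neither includes nor encircles $-1$ as $s$ goes around $\mathcal D_r$ (for all sufficiently large outer radii $\rho$, each large $\rho$ serving for all $\alpha$). Then the closed-loop system with return ratio $-\mathcal L'\mathcal G'(s)$ has stable interarea modes inside $\mathcal D_r$. -/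

import Mathlib

open Matrix Filter Topology Set
open scoped Pointwise

noncomputable section

namespace Nyquist

/-! ### The linearized power network -/

/-- Active power injected into the lossless network at bus `i` when the voltage magnitudes are `V`,
the line susceptances are `b` and the voltage phase angles are `δ`. -/
def powerFlow {n : ℕ} (V : Fin n → ℝ) (b : Fin n → Fin n → ℝ) (i : Fin n) (δ : Fin n → ℝ) : ℝ :=
  ∑ l, V i * V l * b i l * Real.sin (δ i - δ l)

/-- The network matrix `𝓛`: the Jacobian of the power flow at the operating point `δ`. -/
def networkMatrix {n : ℕ} (V : Fin n → ℝ) (b : Fin n → Fin n → ℝ) (δ : Fin n → ℝ) :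
    Matrix (Fin n) (Fin n) ℝ :=
  Matrix.of fun i j => deriv (fun x => powerFlow V b i (Function.update δ j x)) (δ j)

/-- The graph on the buses in which `i ≠ j` are adjacent when `𝓛 i j` or `𝓛 j i` is nonzero. -/
def networkGraph {n : ℕ} (L : Matrix (Fin n) (Fin n) ℝ) : SimpleGraph (Fin n) :=
  SimpleGraph.fromRel fun i j => L i j ≠ 0

/-- The network incidence parameters `γ i = 2 𝓛 i i`. -/
def incidence {n : ℕ} (L : Matrix (Fin n) (Fin n) ℝ) (i : Fin n) : ℝ := 2 * L i i

/-- The normalized network matrix `𝓛' = Γ^(-1/2) 𝓛 Γ^(-1/2)`. -/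
def normalizedNetwork {n : ℕ} (L : Matrix (Fin n) (Fin n) ℝ) : Matrix (Fin n) (Fin n) ℝ :=
  diagonal (fun i => (√(incidence L i))⁻¹) * L * diagonal (fun i => (√(incidence L i))⁻¹)

/-! ### The agents -/

/-- The denominator `s² M + s F(s) + R(s)` of an agent. -/
def agentDenominator (M : ℝ) (F R : ℂ → ℂ) (s : ℂ) : ℂ := s ^ 2 * M + s * F s + R s

/-- The agent `g(s) = 1 / (s² M + s F(s) + R(s))` as a meromorphic function on `ℂ`. Passing to the
normal form gives `g` its limit value at each of its removable singularities (such as the poles of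
`F` and `R`), so that `g` is analytic wherever it has no pole. -/
def agent (M : ℝ) (F R : ℂ → ℂ) : ℂ → ℂ :=
  toMeromorphicNFOn (fun s => 1 / agentDenominator M F R s) univ

/-- The normalized agent dynamics `𝓖'(s) = Γ^(1/2) diag(g₁(s), …, gₙ(s)) Γ^(1/2)`. -/
def normalizedAgents {n : ℕ} (L : Matrix (Fin n) (Fin n) ℝ) (M : Fin n → ℝ) (F R : Fin n → ℂ → ℂ)
    (s : ℂ) : Matrix (Fin n) (Fin n) ℂ :=
  diagonal (fun i => ((√(incidence L i) : ℝ) : ℂ)) * diagonal (fun i => agent (M i) (F i) (R i) s) *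
    diagonal (fun i => ((√(incidence L i) : ℝ) : ℂ))

/-! ### Poles and closed-loop modes of transfer matrices -/

/-- The transfer matrix `Q` has a pole at `s`. -/
def HasPole {κ : Type*} (Q : ℂ → Matrix κ κ ℂ) (s : ℂ) : Prop :=
  ∃ i j, meromorphicOrderAt (fun z => Q z i j) s < 0

/-- `s` is a mode of the closed loop with return ratio `-Q`, that is, a root of the closed-loop
characteristic function `φ_cl = φ_ol · det (I + Q)`. Here `φ_ol` is the (Smith-McMillan) pole
polynomial of `Q`, the least common denominator of all minors of `Q` (including the empty minor
`1`). Its multiplicity at `s` is the maximum over all minors `m` of `-ord_s m`, so `φ_cl` vanishes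
at `s` exactly when some minor has a smaller order at `s` than `det (I + Q)`. (If `det (I + Q)`
vanishes identically, its order is `⊤` and every `s` is a mode.) -/
def IsClosedLoopMode {κ : Type*} [Fintype κ] [DecidableEq κ] (Q : ℂ → Matrix κ κ ℂ) (s : ℂ) :
    Prop :=
  ∃ (k : ℕ) (f g : Fin k → κ),
    meromorphicOrderAt (fun z => ((Q z).submatrix f g).det) s <
      meromorphicOrderAt (fun z => (1 + Q z).det) s

/-- The entrywise inclusion of real into complex matrices. -/
def toComplex {m k : Type*} (A : Matrix m k ℝ) : Matrix m k ℂ := A.map Complex.ofReal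

/-- The orthonormal eigenvectors `Û` of the symmetric matrix `A` that belong to its nonzero
eigenvalues. -/
def interareaBasis {n : ℕ} {A : Matrix (Fin n) (Fin n) ℝ} (hA : A.IsHermitian) :
    Matrix (Fin n) {i : Fin n // hA.eigenvalues i ≠ 0} ℝ :=
  Matrix.of fun i k => (hA.eigenvectorUnitary : Matrix (Fin n) (Fin n) ℝ) i k.1

/-- The interarea loop transfer matrix `Ûᵀ G(s) Û X̂`, where `A = Û X̂ Ûᵀ` is the eigenvalue
decomposition of `A` with the kernel (for the network: the average mode) split off. -/
def interareaLoop {n : ℕ} {A : Matrix (Fin n) (Fin n) ℝ} (hA : A.IsHermitian)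
    (G : ℂ → Matrix (Fin n) (Fin n) ℂ) (s : ℂ) :
    Matrix {i : Fin n // hA.eigenvalues i ≠ 0} {i : Fin n // hA.eigenvalues i ≠ 0} ℂ :=
  (toComplex (interareaBasis hA))ᵀ * G s * toComplex (interareaBasis hA) *
    diagonal (fun k => (hA.eigenvalues k.1 : ℂ))

/-- The closed loop with return ratio `-A G(s)` has stable interarea modes in the region `S`: the
interarea loop has no closed-loop mode in `S`, and the closed-loop transfer matrix
`A (I + G(s) A)⁻¹` has no pole in `S`. -/
def HasStableInterareaModesIn {n : ℕ} {A : Matrix (Fin n) (Fin n) ℝ} (hA : A.IsHermitian)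
    (G : ℂ → Matrix (Fin n) (Fin n) ℂ) (S : Set ℂ) : Prop :=
  (∀ s ∈ S, ¬ IsClosedLoopMode (interareaLoop hA G) s) ∧
    ∀ s ∈ S, ¬ HasPole (fun z => toComplex A * (1 + G z * toComplex A)⁻¹) s

/-! ### The modified Nyquist contour -/

/-- The real part of the modified Nyquist contour at height `ω`. The contour follows the imaginary
axis, with a half-disc indentation of radius `r` at the origin and, for each `(c, ρ) ∈ P`, a
half-disc indentation of radius `ρ` at `jc`. (`√` of a negative number is `0`.) -/
def indentation (r : ℝ) (P : Finset (ℝ × ℝ)) (ω : ℝ) : ℝ :=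
  P.fold max √(r ^ 2 - ω ^ 2) fun p => √(p.2 ^ 2 - (ω - p.1) ^ 2)

/-- The point at height `ω` of the indented imaginary axis. -/
def axisPoint (r : ℝ) (P : Finset (ℝ × ℝ)) (ω : ℝ) : ℂ := ⟨indentation r P ω, ω⟩

/-- The region inside the modified Nyquist contour: the open right half-plane without the
indentations. -/
def insideContour (r : ℝ) (P : Finset (ℝ × ℝ)) : Set ℂ := {s | indentation r P s.im < s.re}

/-- The modified Nyquist contour with outer radius `ρ`, as a closed curve on `[-ρ, ρ + π]`, run
clockwise: first up the indented imaginary axis from `-jρ` to `jρ`, then back along the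
semicircle of radius `ρ` in the right half-plane. -/
def contour (r : ℝ) (P : Finset (ℝ × ℝ)) (ρ t : ℝ) : ℂ :=
  if t ≤ ρ then axisPoint r P t
  else ρ * Complex.exp (Complex.I * ((Real.pi / 2 - (t - ρ) : ℝ) : ℂ))

/-! ### Encirclements by the field of values -/

/-- The field of values (numerical range) `{vᴴ A v : vᴴ v = 1}`. -/
def fieldOfValues {κ : Type*} [Fintype κ] (A : Matrix κ κ ℂ) : Set ℂ :=
  {z | ∃ v : κ → ℂ, star v ⬝ᵥ v = 1 ∧ z = star v ⬝ᵥ (A *ᵥ v)}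

/-- The curve `z` on `[a, b]` avoids `w` and winds `N` times around it (anticlockwise): there is a
continuous logarithm `ℓ` of `z - w` that increases by `2πi N`. -/
def HasWindingNumber (z : ℝ → ℂ) (a b : ℝ) (w : ℂ) (N : ℤ) : Prop :=
  ∃ ℓ : ℝ → ℂ, ContinuousOn ℓ (Icc a b) ∧ (∀ t ∈ Icc a b, z t = w + Complex.exp (ℓ t)) ∧
    ℓ b - ℓ a = 2 * Real.pi * Complex.I * N

/-- The moving set `Φ t`, `t ∈ [a, b]`, encircles `w`: some closed continuous curve `z t ∈ Φ t`
has a nonzero winding number around `w`. -/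
def Encircles (Φ : ℝ → Set ℂ) (a b : ℝ) (w : ℂ) : Prop :=
  ∃ z : ℝ → ℂ, ContinuousOn z (Icc a b) ∧ z a = z b ∧ (∀ t ∈ Icc a b, z t ∈ Φ t) ∧
    ∃ N : ℤ, N ≠ 0 ∧ HasWindingNumber z a b w N

/-- The moving set `Φ t`, `t ∈ [a, b]`, neither includes nor encircles `w`. -/
def NotIncludesOrEncircles (Φ : ℝ → Set ℂ) (a b : ℝ) (w : ℂ) : Prop :=
  (∀ t ∈ Icc a b, w ∉ Φ t) ∧ ¬ Encircles Φ a b w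

/-! ### Symmetry of the network matrix -/

theorem networkMatrix_apply {n : ℕ} (V : Fin n → ℝ) (b : Fin n → Fin n → ℝ) (δ : Fin n → ℝ)
    (i j : Fin n) :
    networkMatrix V b δ i j = ∑ l, V i * V l * b i l *
      (Real.cos (δ i - δ l) * ((if i = j then 1 else 0) - (if l = j then 1 else 0))) := by
  have key : ∀ k : Fin n, HasDerivAt (fun x => Function.update δ j x k)
      (if k = j then (1 : ℝ) else 0) (δ j) := by
    intro k
    by_cases h : k = j
    · subst h
      simpa using hasDerivAt_id' (δ k)
    · simpa [Function.update_of_ne h, h] using hasDerivAt_const (δ j) (δ k)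
  have h2 : HasDerivAt (fun x => powerFlow V b i (Function.update δ j x))
      (∑ l, V i * V l * b i l *
        (Real.cos (δ i - δ l) * ((if i = j then 1 else 0) - (if l = j then 1 else 0)))) (δ j) := by
    unfold powerFlow
    refine HasDerivAt.fun_sum fun l _ => ?_
    have := (((key i).sub (key l)).sin).const_mul (V i * V l * b i l)
    simpa using this
  exact h2.deriv

theorem networkMatrix_symm {n : ℕ} (V : Fin n → ℝ) {b : Fin n → Fin n → ℝ} (δ : Fin n → ℝ)
    (hb : ∀ i j, b i j = b j i) (i j : Fin n) :
    networkMatrix V b δ j i = networkMatrix V b δ i j := by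
  by_cases h : i = j
  · rw [h]
  · rw [networkMatrix_apply, networkMatrix_apply]
    have h' : ¬ j = i := fun e => h e.symm
    have hc : Real.cos (δ j - δ i) = Real.cos (δ i - δ j) := by
      rw [← Real.cos_neg, neg_sub]
    simp only [h, h', if_false, zero_sub, mul_neg, mul_ite, mul_one, mul_zero,
      Finset.sum_neg_distrib, Finset.sum_ite_eq', Finset.mem_univ, if_true]
    rw [hc, hb j i]
    ring

theorem isHermitian_normalizedNetwork {n : ℕ} (V : Fin n → ℝ) {b : Fin n → Fin n → ℝ}
    (δ : Fin n → ℝ) (hb : ∀ i j, b i j = b j i) :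
    (normalizedNetwork (networkMatrix V b δ)).IsHermitian := by
  ext i j
  simp only [conjTranspose_apply, normalizedNetwork, mul_diagonal, diagonal_mul, star_trivial]
  rw [networkMatrix_symm V δ hb i j]
  ring

end Nyquist

end

/-! Write `C` for the normalized network matrix and `G` for the normalized agents. The Laplacian
satisfies `0 ≤ L ≤ Γ` as quadratic forms, so `0 ≤ C ≤ 1` and hence `C² ≤ C`. Suppose `1 + τ G C` is
singular for some `τ ∈ [0, 1]`, with kernel vector `v`, and put `w = C v`. Pairing `v + τ G w = 0`
with `w` gives `p + τ wᴴ G w = 0`, where `p = vᴴ C v ≥ vᴴ C² v = wᴴ w = q > 0`. So the unit vector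
along `w` puts `-p / (τ q)` into the field of values of `G`, and `-1` into its multiple by `α = τ q
/ p ∈ (0, 1]` (`exists_neg_one_mem_smul_fieldOfValues`). The field-of-values assumption forbids this
on the contour. Thus `det (1 + τ G C)` has no zero on the contour for any `τ ∈ [0, 1]`. It is
analytic inside and equals `1` at `τ = 0`, so by homotopy it has no zero inside at `τ = 1`
(`ne_zero_of_homotopy`, `det_one_add_mul_ne_zero`). By Sylvester's determinant identity the
interarea loop has the same return difference determinant (`det_one_add_interareaLoop`). Since `G`
is analytic inside, a nonvanishing determinant excludes both interarea modes and poles of the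
closed-loop transfer matrix. -/

namespace Nyquist

/-! ### Zeros along a homotopy of analytic functions -/

/-- Homotopy invariance of the absence of zeros, by the maximum modulus principle applied to the
reciprocals: zeros that never cross the boundary cannot appear in the interior. -/
theorem ne_zero_of_homotopy {U : Set ℂ} (hU : Bornology.IsBounded U) {f : ℝ → ℂ → ℂ}
    (hf : ContinuousOn (fun p : ℝ × ℂ => f p.1 p.2) (Icc 0 1 ×ˢ closure U))
    (hd : ∀ τ ∈ Icc (0 : ℝ) 1, DifferentiableOn ℂ (f τ) U)
    (hb : ∀ τ ∈ Icc (0 : ℝ) 1, ∀ z ∈ frontier U, f τ z ≠ 0)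
    (h0 : ∀ z ∈ closure U, f 0 z ≠ 0) {z : ℂ} (hz : z ∈ closure U) : f 1 z ≠ 0 := by
  have hcl : IsCompact (closure U) := hU.isCompact_closure
  have hfr : IsCompact (frontier U) := hcl.of_isClosed_subset isClosed_frontier frontier_subset_closure
  obtain ⟨c, hc, hcb⟩ : ∃ c : ℝ, 0 < c ∧ ∀ τ ∈ Icc (0 : ℝ) 1, ∀ z ∈ frontier U, c ≤ ‖f τ z‖ := by
    rcases (frontier U).eq_empty_or_nonempty with he | hne
    · exact ⟨1, one_pos, fun τ _ z hz => by simp [he] at hz⟩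
    · obtain ⟨p, hp, hmin⟩ := (isCompact_Icc.prod hfr).exists_isMinOn
        ((nonempty_Icc.2 (zero_le_one' ℝ)).prod hne)
        (hf.mono (prod_mono_right frontier_subset_closure)).norm
      exact ⟨‖f p.1 p.2‖, norm_pos_iff.2 (hb _ hp.1 _ hp.2), fun τ hτ z hz =>
        hmin (mk_mem_prod hτ hz)⟩
  -- The maximum modulus principle for `1 / f τ` carries the boundary bound inside: a zero-free `f
  -- τ` is bounded below by the same `c` for every `τ`.
  have hlow : ∀ τ ∈ Icc (0 : ℝ) 1, (∀ z ∈ closure U, f τ z ≠ 0) →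
      ∀ z ∈ closure U, c ≤ ‖f τ z‖ := by
    intro τ hτ hne z hz
    have hcont : ContinuousOn (f τ) (closure U) :=
      hf.comp (f := fun z => (τ, z)) (by fun_prop) fun z hz => mk_mem_prod hτ hz
    have hdc : DiffContOnCl ℂ (fun z => (f τ z)⁻¹) U :=
      ⟨(hd τ hτ).inv fun z hz => hne z (subset_closure hz), hcont.inv₀ hne⟩
    have := Complex.norm_le_of_forall_mem_frontier_norm_le hU hdc (C := c⁻¹)
      (fun z hz => by
        rw [norm_inv]
        exact inv_anti₀ hc (hcb τ hτ z hz)) hz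
    rw [norm_inv] at this
    exact (inv_le_inv₀ (norm_pos_iff.2 (hne z hz)) hc).1 this
  obtain ⟨ε, hε, hu⟩ := Metric.uniformContinuousOn_iff.1
    ((isCompact_Icc.prod hcl).uniformContinuousOn_of_continuous hf) c hc
  -- Zero-freeness spreads in steps of `ε / 2`, which keeps the distance strictly below `ε`: each
  -- step changes `f` by less than `c`, too little to create a zero.
  have hstep : ∀ k : ℕ, ∀ τ ∈ Icc (0 : ℝ) 1, τ ≤ k * (ε / 2) → ∀ z ∈ closure U, f τ z ≠ 0 := by
    intro k
    induction k with
    | zero =>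
      intro τ hτ hk
      have : τ = 0 := le_antisymm (by simpa using hk) hτ.1
      simpa [this] using h0
    | succ k ih =>
      intro τ hτ hk z hz hfz
      have hσ : max 0 (τ - ε / 2) ∈ Icc (0 : ℝ) 1 :=
        ⟨le_max_left _ _, max_le zero_le_one (by linarith [hτ.2])⟩
      have hσk : max 0 (τ - ε / 2) ≤ k * (ε / 2) := by
        push_cast at hk
        exact max_le (by positivity) (by linarith)
      have h1 := hlow _ hσ (ih _ hσ hσk) z hz
      have hdist : dist (max 0 (τ - ε / 2), z) (τ, z) < ε := by
        rw [dist_prod_same_right, Real.dist_eq, abs_lt]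
        constructor
        · linarith [le_max_right 0 (τ - ε / 2)]
        · linarith [max_le hτ.1 (show τ - ε / 2 ≤ τ by linarith)]
      have h2 := hu _ (mk_mem_prod hσ hz) _ (mk_mem_prod hτ hz) hdist
      simp only [hfz, dist_zero_right] at h2
      exact absurd h1 (not_le.2 h2)
  obtain ⟨k, hk⟩ := exists_nat_ge (1 / (ε / 2))
  exact hstep k 1 (by simp) ((div_le_iff₀ (by positivity)).1 hk) z hz

/-! ### Analytic transfer matrices -/

theorem analyticAt_det {κ : Type*} [Fintype κ] [DecidableEq κ] {Q : ℂ → Matrix κ κ ℂ} {s : ℂ}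
    (h : ∀ i j, AnalyticAt ℂ (fun z => Q z i j) s) : AnalyticAt ℂ (fun z => (Q z).det) s := by
  simp only [det_apply']
  exact Finset.analyticAt_fun_sum _ fun σ _ =>
    analyticAt_const.mul (Finset.analyticAt_fun_prod _ fun i _ => h _ _)

theorem analyticAt_matrix_mul {ι κ μ : Type*} [Fintype κ] {Q : ℂ → Matrix ι κ ℂ}
    {T : ℂ → Matrix κ μ ℂ} {s : ℂ} (hQ : ∀ i j, AnalyticAt ℂ (fun z => Q z i j) s)
    (hT : ∀ i j, AnalyticAt ℂ (fun z => T z i j) s) (i : ι) (j : μ) :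
    AnalyticAt ℂ (fun z => (Q z * T z) i j) s := by
  simp only [mul_apply]
  exact Finset.analyticAt_fun_sum _ fun k _ => (hQ _ _).mul (hT _ _)

theorem analyticAt_matrix_const {ι κ : Type*} (A : Matrix ι κ ℂ) (s : ℂ) (i : ι) (j : κ) :
    AnalyticAt ℂ (fun _ => A i j) s :=
  analyticAt_const

theorem analyticAt_one_add {κ : Type*} [DecidableEq κ] {Q : ℂ → Matrix κ κ ℂ} {s : ℂ}
    (hQ : ∀ i j, AnalyticAt ℂ (fun z => Q z i j) s) (i j : κ) :
    AnalyticAt ℂ (fun z => (1 + Q z) i j) s := by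
  simp only [Matrix.add_apply]
  exact analyticAt_const.add (hQ i j)

/-- Cramer's rule: the adjugate entries are determinants of `Q` with one row replaced by a constant
unit vector. -/
theorem analyticAt_inv {κ : Type*} [Fintype κ] [DecidableEq κ] {Q : ℂ → Matrix κ κ ℂ} {s : ℂ}
    (h : ∀ i j, AnalyticAt ℂ (fun z => Q z i j) s) (hdet : (Q s).det ≠ 0) (i j : κ) :
    AnalyticAt ℂ (fun z => (Q z)⁻¹ i j) s := by
  simp only [inv_def, Ring.inverse_eq_inv, Matrix.smul_apply, smul_eq_mul, adjugate_apply]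
  refine ((analyticAt_det h).inv hdet).mul (analyticAt_det fun k l => ?_)
  by_cases hk : k = j
  · subst hk
    simpa only [updateRow_self] using analyticAt_const
  · simpa only [updateRow_ne hk] using h k l

/-- All minors of an analytic `Q` have order at least `0`, while the determinant has order exactly
`0`. -/
theorem not_isClosedLoopMode {κ : Type*} [Fintype κ] [DecidableEq κ] {Q : ℂ → Matrix κ κ ℂ} {s : ℂ}
    (h : ∀ i j, AnalyticAt ℂ (fun z => Q z i j) s) (hdet : (1 + Q s).det ≠ 0) :
    ¬ IsClosedLoopMode Q s := by
  rintro ⟨k, f, g, hlt⟩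
  have h1 := analyticAt_det (analyticAt_one_add h)
  rw [h1.meromorphicOrderAt_eq, h1.analyticOrderAt_eq_zero.2 hdet] at hlt
  exact not_lt.2 (analyticAt_det (Q := fun z => (Q z).submatrix f g)
    fun i j => h _ _).meromorphicOrderAt_nonneg (by simpa using hlt)

/-! ### The field of values and the network matrix -/

section

open scoped ComplexOrder

/-- The numerical range of `G` meets `(-∞, -1]` whenever `1 + τ G C` is singular for some `τ ≤ 1` and
some Hermitian `C` with `0 ≤ C ≤ 1`. -/
theorem exists_neg_one_mem_smul_fieldOfValues {κ : Type*} [Fintype κ] [DecidableEq κ]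
    {G C : Matrix κ κ ℂ} (hC : C.PosSemidef) (hC1 : (1 - C).PosSemidef) {τ : ℝ}
    (hτ : τ ∈ Icc (0 : ℝ) 1) (hdet : (1 + (τ : ℂ) • (G * C)).det = 0) :
    ∃ α : ℝ, 0 < α ∧ α ≤ 1 ∧ (-1 : ℂ) ∈ α • fieldOfValues G := by
  obtain ⟨v, hv, hGv⟩ := exists_mulVec_eq_zero_iff.2 hdet
  obtain ⟨w, hw⟩ : ∃ w, w = C *ᵥ v := ⟨_, rfl⟩
  have hGw : v + (τ : ℂ) • (G *ᵥ w) = 0 := by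
    rw [add_mulVec, one_mulVec, smul_mulVec, ← mulVec_mulVec, ← hw] at hGv
    exact hGv
  have hw0 : w ≠ 0 := by
    rintro h
    simp only [h, mulVec_zero, smul_zero, add_zero] at hGw
    exact hv hGw
  have hstar : star w = star v ᵥ* C := by
    rw [hw, star_mulVec, hC.isHermitian.eq]
  obtain ⟨q, hq, hqe⟩ : ∃ q : ℝ, 0 < q ∧ star w ⬝ᵥ w = q := by
    have h : 0 < star w ⬝ᵥ w := dotProduct_star_self_pos_iff.2 hw0
    exact ⟨_, (Complex.lt_def.1 h).1, Complex.ext rfl (Complex.lt_def.1 h).2.symm⟩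
  obtain ⟨p, hpe⟩ : ∃ p : ℝ, star v ⬝ᵥ w = p := by
    have := hC.dotProduct_mulVec_nonneg v
    rw [← hw] at this
    exact ⟨_, Complex.ext rfl (Complex.le_def.1 this).2.symm⟩
  have hpe' : star w ⬝ᵥ v = p := by
    rw [hstar, ← dotProduct_mulVec, ← hw, hpe]
  -- This is `C² ≤ C`, from `C - C² = C (1 - C) C + (1 - C) C (1 - C)` evaluated at `v`, with `w = C
  -- v` and `v - w = (1 - C) v`.
  have hqp : q ≤ p := by
    have h1 := hC1.dotProduct_mulVec_nonneg w
    have h2 := hC.dotProduct_mulVec_nonneg (v - w)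
    have h3 : star w ⬝ᵥ ((1 - C) *ᵥ w) + star (v - w) ⬝ᵥ (C *ᵥ (v - w)) = ((p - q : ℝ) : ℂ) := by
      have e : star v ⬝ᵥ (C *ᵥ w) = q := by rw [dotProduct_mulVec, ← hstar, hqe]
      rw [sub_mulVec, one_mulVec, mulVec_sub, ← hw, star_sub]
      simp only [dotProduct_sub, sub_dotProduct, hqe, hpe, e]
      push_cast
      ring
    have h4 := add_nonneg h1 h2
    rw [h3] at h4
    linarith [Complex.zero_le_real.1 h4]
  have hp : 0 < p := hq.trans_le hqp
  have hsum : (p : ℂ) + τ * (star w ⬝ᵥ (G *ᵥ w)) = 0 := by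
    have := congrArg (fun x => star w ⬝ᵥ x) hGw
    simpa only [dotProduct_add, dotProduct_smul, smul_eq_mul, hpe', dotProduct_zero] using this
  have hτ0 : 0 < τ := by
    refine hτ.1.lt_of_ne' ?_
    rintro rfl
    simp only [Complex.ofReal_zero, zero_mul, add_zero, Complex.ofReal_eq_zero] at hsum
    exact hp.ne' hsum
  have hqc : (q : ℂ) ≠ 0 := by exact_mod_cast hq.ne'
  have hpc : (p : ℂ) ≠ 0 := by exact_mod_cast hp.ne'
  have hsq : (((√q)⁻¹ : ℝ) : ℂ) * (((√q)⁻¹ : ℝ) : ℂ) = (q : ℂ)⁻¹ := by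
    rw [← Complex.ofReal_mul, ← mul_inv, Real.mul_self_sqrt hq.le, Complex.ofReal_inv]
  have hscale : ∀ x : κ → ℂ, star ((((√q)⁻¹ : ℝ) : ℂ) • w) ⬝ᵥ ((((√q)⁻¹ : ℝ) : ℂ) • x) =
      (q : ℂ)⁻¹ * (star w ⬝ᵥ x) := by
    intro x
    rw [star_smul, smul_dotProduct, dotProduct_smul, smul_smul, Complex.star_def,
      Complex.conj_ofReal, hsq, smul_eq_mul]
  -- The witness is `w / √q`; its value `wᴴ G w / q = -p / (τ q)` fixes the scaling `α = τ q / p`.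
  refine ⟨τ * q / p, by positivity, ?_, (q : ℂ)⁻¹ * (star w ⬝ᵥ (G *ᵥ w)),
    ⟨(((√q)⁻¹ : ℝ) : ℂ) • w, ?_, ?_⟩, ?_⟩
  · rw [div_le_one hp]
    nlinarith [hτ.2]
  · rw [hscale, hqe, inv_mul_cancel₀ hqc]
  · rw [mulVec_smul, hscale]
  · simp only [Complex.real_smul]
    push_cast
    field_simp
    linear_combination hsum

open scoped MatrixOrder Matrix.Norms.L2Operator in
-- A real factorization `A = BᵀB` remains a Gram factorization over `ℂ`.
theorem posSemidef_toComplex {κ : Type*} [Fintype κ] [DecidableEq κ] {A : Matrix κ κ ℝ}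
    (hA : A.PosSemidef) : (toComplex A).PosSemidef := by
  obtain ⟨B, rfl⟩ := CStarAlgebra.nonneg_iff_eq_star_mul_self.1 hA.nonneg
  have : toComplex (star B * B) = (toComplex B)ᴴ * toComplex B := by
    ext i j
    simp [toComplex, mul_apply, star_apply]
  rw [this]
  exact posSemidef_conjTranspose_mul_self _

end

/-! ### Spectral bounds for the network Laplacian -/

section Laplacian

variable {κ : Type*} [Fintype κ] [DecidableEq κ] {L : Matrix κ κ ℝ}

/-- In `∑ L i j (x i - x j)²` the pure squares cancel because rows and columns sum to zero, leaving
`-2 xᵀ L x`. -/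
theorem posSemidef_of_laplacian (hs : ∀ i j, L j i = L i j) (hr : ∀ i, ∑ j, L i j = 0)
    (hL : ∀ i j, i ≠ j → L i j ≤ 0) : L.PosSemidef := by
  refine .of_dotProduct_mulVec_nonneg (by ext i j; simp [hs]) fun x => ?_
  have h1 : ∑ i, ∑ j, L i j * (x i - x j) ^ 2 = -2 * (star x ⬝ᵥ (L *ᵥ x)) := by
    have e1 : ∑ i, ∑ j, L i j * x i ^ 2 = 0 := by simp [← Finset.sum_mul, hr]
    have e2 : ∑ i, ∑ j, L i j * x j ^ 2 = 0 := by
      rw [Finset.sum_comm]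
      simp [← Finset.sum_mul, ← hs, hr]
    have e3 : star x ⬝ᵥ (L *ᵥ x) = ∑ i, ∑ j, L i j * (x i * x j) := by
      simp only [dotProduct, mulVec, star_trivial, Finset.mul_sum]
      exact Finset.sum_congr rfl fun i _ => Finset.sum_congr rfl fun j _ => by ring
    have e4 : ∑ i, ∑ j, L i j * (x i - x j) ^ 2 = ∑ i, ∑ j, L i j * x i ^ 2 +
        ∑ i, ∑ j, L i j * x j ^ 2 + -2 * ∑ i, ∑ j, L i j * (x i * x j) := by
      simp only [Finset.mul_sum, ← Finset.sum_add_distrib]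
      exact Finset.sum_congr rfl fun i _ => Finset.sum_congr rfl fun j _ => by ring
    rw [e4, e1, e2, e3]
    ring
  have h2 : ∑ i, ∑ j, L i j * (x i - x j) ^ 2 ≤ 0 := by
    refine Finset.sum_nonpos fun i _ => Finset.sum_nonpos fun j _ => ?_
    by_cases h : i = j
    · simp [h]
    · exact mul_nonpos_of_nonpos_of_nonneg (hL i j h) (sq_nonneg _)
  linarith

/-- With `x i + x j` the sum becomes `2 xᵀ L x`. Its off-diagonal terms are nonpositive, and its
diagonal terms are `4 L i i (x i)²`; this is where the factor `2` in `γ i` comes from. -/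
theorem posSemidef_two_diagonal_sub_laplacian (hs : ∀ i j, L j i = L i j)
    (hr : ∀ i, ∑ j, L i j = 0) (hL : ∀ i j, i ≠ j → L i j ≤ 0) :
    (diagonal (fun i => 2 * L i i) - L).PosSemidef := by
  refine .of_dotProduct_mulVec_nonneg ?_ fun x => ?_
  · exact (isHermitian_diagonal _).sub (by ext i j; simp [hs])
  have h1 : ∑ i, ∑ j, L i j * (x i + x j) ^ 2 = 2 * (star x ⬝ᵥ (L *ᵥ x)) := by
    have e1 : ∑ i, ∑ j, L i j * x i ^ 2 = 0 := by simp [← Finset.sum_mul, hr]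
    have e2 : ∑ i, ∑ j, L i j * x j ^ 2 = 0 := by
      rw [Finset.sum_comm]
      simp [← Finset.sum_mul, ← hs, hr]
    have e3 : star x ⬝ᵥ (L *ᵥ x) = ∑ i, ∑ j, L i j * (x i * x j) := by
      simp only [dotProduct, mulVec, star_trivial, Finset.mul_sum]
      exact Finset.sum_congr rfl fun i _ => Finset.sum_congr rfl fun j _ => by ring
    have e4 : ∑ i, ∑ j, L i j * (x i + x j) ^ 2 = ∑ i, ∑ j, L i j * x i ^ 2 +
        ∑ i, ∑ j, L i j * x j ^ 2 + 2 * ∑ i, ∑ j, L i j * (x i * x j) := by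
      simp only [Finset.mul_sum, ← Finset.sum_add_distrib]
      exact Finset.sum_congr rfl fun i _ => Finset.sum_congr rfl fun j _ => by ring
    rw [e4, e1, e2, e3]
    ring
  have h2 : ∑ i, ∑ j, L i j * (x i + x j) ^ 2 ≤ ∑ i, 4 * (L i i * x i ^ 2) := by
    refine Finset.sum_le_sum fun i _ => ?_
    rw [← Finset.add_sum_erase _ _ (Finset.mem_univ i)]
    have : ∑ j ∈ Finset.univ.erase i, L i j * (x i + x j) ^ 2 ≤ 0 :=
      Finset.sum_nonpos fun j hj => mul_nonpos_of_nonpos_of_nonneg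
        (hL i j (Finset.ne_of_mem_erase hj).symm) (sq_nonneg _)
    nlinarith
  have h3 : star x ⬝ᵥ (diagonal (fun i => 2 * L i i) *ᵥ x) = ∑ i, 2 * (L i i * x i ^ 2) := by
    simp only [dotProduct, mulVec_diagonal, star_trivial]
    exact Finset.sum_congr rfl fun i _ => by ring
  rw [sub_mulVec, dotProduct_sub, h3]
  rw [← Finset.mul_sum] at h2 ⊢
  linarith

/-- In a connected graph with at least two vertices every vertex has a neighbour, so the
off-diagonal row sum is strictly negative. This makes `Γ` invertible. -/
theorem laplacian_diag_pos [Nontrivial κ] {L : Matrix κ κ ℝ} (hs : ∀ i j, L j i = L i j)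
    (hr : ∀ i, ∑ j, L i j = 0) (hL : ∀ i j, i ≠ j → L i j ≤ 0)
    (hc : (SimpleGraph.fromRel fun i j => L i j ≠ 0).Connected) (i : κ) : 0 < L i i := by
  obtain ⟨j, hj⟩ := hc.preconnected.exists_adj_of_nontrivial i
  rw [SimpleGraph.fromRel_adj] at hj
  have hij : L i j ≠ 0 := by
    rcases hj.2 with h | h
    · exact h
    · rwa [hs] at h
  have h1 := hr i
  rw [← Finset.add_sum_erase _ _ (Finset.mem_univ i)] at h1
  have h2 : ∑ k ∈ Finset.univ.erase i, L i k < 0 :=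
    Finset.sum_neg' (fun k hk => hL i k (Finset.ne_of_mem_erase hk).symm)
      ⟨j, Finset.mem_erase.2 ⟨hj.1.symm, Finset.mem_univ _⟩, (hL i j hj.1).lt_of_ne hij⟩
  linarith

end Laplacian

/-- The power flow depends only on angle differences, so a common shift of all angles is in the
kernel. -/
theorem networkMatrix_row_sum {n : ℕ} (V : Fin n → ℝ) (b : Fin n → Fin n → ℝ) (δ : Fin n → ℝ)
    (i : Fin n) : ∑ j, networkMatrix V b δ i j = 0 := by
  simp only [networkMatrix_apply]
  rw [Finset.sum_comm]
  refine Finset.sum_eq_zero fun l _ => ?_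
  rw [← Finset.mul_sum, ← Finset.mul_sum]
  simp

section Normalized

variable {n : ℕ} {L : Matrix (Fin n) (Fin n) ℝ}

theorem posSemidef_normalizedNetwork (hL : L.PosSemidef) : (normalizedNetwork L).PosSemidef := by
  have := hL.mul_mul_conjTranspose_same (diagonal fun i => (√(incidence L i))⁻¹)
  rwa [diagonal_conjTranspose, star_trivial] at this

/-- Congruence of `Γ - L ≥ 0` by `Γ^(-1/2)`. -/
theorem posSemidef_one_sub_normalizedNetwork (hpos : ∀ i, 0 < L i i)
    (hL : (diagonal (fun i => 2 * L i i) - L).PosSemidef) :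
    (1 - normalizedNetwork L).PosSemidef := by
  have := hL.mul_mul_conjTranspose_same (diagonal fun i => (√(incidence L i))⁻¹)
  rw [diagonal_conjTranspose, star_trivial, mul_sub, sub_mul, diagonal_mul_diagonal,
    diagonal_mul_diagonal] at this
  convert this using 1
  rw [normalizedNetwork, sub_left_inj, ← diagonal_one]
  congr 1
  ext i
  have hi : 0 < incidence L i := mul_pos two_pos (hpos i)
  have h2 : √(incidence L i) ≠ 0 := (Real.sqrt_pos.2 hi).ne'
  have h3 : 2 * L i i = √(incidence L i) * √(incidence L i) := (Real.mul_self_sqrt hi.le).symm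
  rw [h3]
  field_simp

end Normalized

/-! ### The interarea loop -/

/-- Zero eigenvalues contribute nothing to the spectral decomposition. -/
theorem interareaBasis_mul {n : ℕ} {A : Matrix (Fin n) (Fin n) ℝ} (hA : A.IsHermitian) :
    interareaBasis hA * (diagonal (fun k => hA.eigenvalues k.1) :
      Matrix {i // hA.eigenvalues i ≠ 0} {i // hA.eigenvalues i ≠ 0} ℝ) * (interareaBasis hA)ᵀ = A := by
  conv_rhs => rw [hA.spectral_theorem]
  ext i j
  rw [Unitary.conjStarAlgAut_apply, mul_apply, mul_apply]
  simp only [mul_diagonal, transpose_apply, interareaBasis, of_apply, star_apply,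
    star_trivial, Function.comp_apply, RCLike.ofReal_real_eq_id, id_eq]
  rw [← Finset.sum_subtype (Finset.univ.filter fun k => hA.eigenvalues k ≠ 0) (by simp)
    (fun k => (hA.eigenvectorUnitary : Matrix (Fin n) (Fin n) ℝ) i k * hA.eigenvalues k *
      (hA.eigenvectorUnitary : Matrix (Fin n) (Fin n) ℝ) j k), Finset.sum_filter]
  refine Finset.sum_congr rfl fun k _ => ?_
  split_ifs with h
  · rfl
  · simp [not_not.1 h]

theorem det_one_add_interareaLoop {n : ℕ} {A : Matrix (Fin n) (Fin n) ℝ} (hA : A.IsHermitian)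
    (G : ℂ → Matrix (Fin n) (Fin n) ℂ) (s : ℂ) :
    (1 + interareaLoop hA G s).det = (1 + G s * toComplex A).det := by
  have h : toComplex A = toComplex (interareaBasis hA) *
      (diagonal (fun k => (hA.eigenvalues k.1 : ℂ)) :
      Matrix {i // hA.eigenvalues i ≠ 0} {i // hA.eigenvalues i ≠ 0} ℂ) * (toComplex (interareaBasis hA))ᵀ := by
    conv_lhs => rw [← interareaBasis_mul hA]
    ext i j
    rw [toComplex, map_apply, mul_apply, mul_apply]
    simp [toComplex, mul_diagonal]
  unfold interareaLoop
  rw [Matrix.mul_assoc, Matrix.mul_assoc, det_one_add_mul_comm, h]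
  simp only [Matrix.mul_assoc]

/-! ### The contour and its interior -/

theorem indentation_nonneg (r : ℝ) (P : Finset (ℝ × ℝ)) (ω : ℝ) : 0 ≤ indentation r P ω :=
  (Finset.le_fold_max 0).2 (.inl (Real.sqrt_nonneg _))

theorem continuous_indentation (r : ℝ) (P : Finset (ℝ × ℝ)) : Continuous (indentation r P) := by
  classical
  unfold indentation
  induction P using Finset.induction_on with
  | empty => simp only [Finset.fold_empty]; fun_prop
  | insert p P hp ih =>
    simp only [Finset.fold_insert hp]
    exact Continuous.max (by fun_prop) ih

theorem isOpen_insideContour (r : ℝ) (P : Finset (ℝ × ℝ)) : IsOpen (insideContour r P) :=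
  isOpen_lt ((continuous_indentation r P).comp Complex.continuous_im) Complex.continuous_re

theorem closure_insideContour_inter_ball {r : ℝ} {P : Finset (ℝ × ℝ)} {ρ : ℝ} {s : ℂ}
    (hs : s ∈ closure (insideContour r P ∩ Metric.ball 0 ρ)) :
    indentation r P s.im ≤ s.re ∧ ‖s‖ ≤ ρ := by
  have hc : IsClosed {s : ℂ | indentation r P s.im ≤ s.re ∧ ‖s‖ ≤ ρ} :=
    (isClosed_le ((continuous_indentation r P).comp Complex.continuous_im)
      Complex.continuous_re).inter (isClosed_le continuous_norm continuous_const)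
  refine closure_minimal ?_ hc hs
  rintro z ⟨h1, h2⟩
  exact ⟨le_of_lt h1, (mem_ball_zero_iff.1 h2).le⟩

/-- The boundary of the bounded region enclosed by the contour lies on the contour. -/
theorem exists_contour_eq_of_mem_frontier {r : ℝ} {P : Finset (ℝ × ℝ)} {ρ : ℝ} {s : ℂ}
    (hs : s ∈ frontier (insideContour r P ∩ Metric.ball 0 ρ)) :
    ∃ t ∈ Icc (-ρ) (ρ + Real.pi), contour r P ρ t = s := by
  have hopen : IsOpen (insideContour r P ∩ Metric.ball 0 ρ) :=
    (isOpen_insideContour r P).inter Metric.isOpen_ball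
  rw [hopen.frontier_eq] at hs
  obtain ⟨h1, h2⟩ := closure_insideContour_inter_ball hs.1
  have him := abs_le.1 ((Complex.abs_im_le_norm s).trans h2)
  by_cases he : indentation r P s.im = s.re
  · exact ⟨s.im, ⟨him.1, by linarith [him.2, Real.pi_pos]⟩, by
      rw [contour, if_pos him.2, axisPoint, he]⟩
  -- Off the indented axis the point has positive real part and lies on the outer circle. Its
  -- argument is then strictly less than `π / 2`, so the parameter below exceeds `ρ` and selects the
  -- arc branch of `contour`.
  have hre : 0 < s.re := (indentation_nonneg r P s.im).trans_lt (h1.lt_of_ne he)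
  have hn : ‖s‖ = ρ := by
    refine h2.eq_of_not_lt fun hlt => hs.2 ⟨h1.lt_of_ne he, mem_ball_zero_iff.2 hlt⟩
  have harg := abs_lt.1 (Complex.abs_arg_lt_pi_div_two_iff.2 (.inl hre))
  refine ⟨ρ + (Real.pi / 2 - s.arg), ⟨?_, by linarith⟩, ?_⟩
  · linarith [(norm_nonneg s).trans h2]
  · rw [contour, if_neg (by linarith), add_sub_cancel_left, sub_sub_cancel, mul_comm Complex.I,
      ← hn, Complex.norm_mul_exp_arg_mul_I]

/-! ### Nonsingularity of the return difference -/

/-- The diagonal entries are nonzero multiples of agents in meromorphic normal form, for which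
nonnegative order already means analyticity. -/
theorem analyticAt_normalizedAgents {n : ℕ} {L : Matrix (Fin n) (Fin n) ℝ} (hL : ∀ i, 0 < L i i)
    (M : Fin n → ℝ) (F R : Fin n → ℂ → ℂ) {s : ℂ}
    (hs : ¬ HasPole (normalizedAgents L M F R) s) (i j : Fin n) :
    AnalyticAt ℂ (fun z => normalizedAgents L M F R z i j) s := by
  simp only [HasPole, not_exists, not_lt] at hs
  by_cases hij : i = j
  · subst hij
    have hi : ((√(incidence L i) : ℝ) : ℂ) * ((√(incidence L i) : ℝ) : ℂ) ≠ 0 := by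
      have := (Real.sqrt_pos.2 (mul_pos two_pos (hL i) : 0 < incidence L i)).ne'
      exact mul_ne_zero (by exact_mod_cast this) (by exact_mod_cast this)
    have he : (fun z => normalizedAgents L M F R z i i) =
        (fun _ => ((√(incidence L i) : ℝ) : ℂ) * ((√(incidence L i) : ℝ) : ℂ)) *
          agent (M i) (F i) (R i) := by
      ext z
      simp only [normalizedAgents, diagonal_mul_diagonal, diagonal_apply_eq, Pi.mul_apply]
      ring
    have h := hs i i
    rw [he, meromorphicOrderAt_mul_of_ne_zero analyticAt_const hi] at h
    rw [he]
    exact analyticAt_const.mul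
      ((meromorphicNFOn_toMeromorphicNFOn _ _ (mem_univ s)).meromorphicOrderAt_nonneg_iff_analyticAt.1 h)
  · have he : (fun z => normalizedAgents L M F R z i j) = fun _ => 0 := by
      ext z
      simp [normalizedAgents, hij]
    rw [he]
    exact analyticAt_const

section

open scoped ComplexOrder

/-- The homotopy scales the loop gain by `τ`, from the open loop, with determinant `1`, to the full
loop. -/
theorem det_one_add_mul_ne_zero {κ : Type*} [Fintype κ] [DecidableEq κ] {U : Set ℂ}
    (hU : Bornology.IsBounded U) {G : ℂ → Matrix κ κ ℂ} {C : Matrix κ κ ℂ} (hC : C.PosSemidef)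
    (hC1 : (1 - C).PosSemidef)
    (hG : ∀ s ∈ closure U, ∀ i j, AnalyticAt ℂ (fun z => G z i j) s)
    (hF : ∀ s ∈ frontier U, ∀ α : ℝ, 0 < α → α ≤ 1 → (-1 : ℂ) ∉ α • fieldOfValues (G s))
    {s : ℂ} (hs : s ∈ closure U) : (1 + G s * C).det ≠ 0 := by
  have key := ne_zero_of_homotopy hU (f := fun τ z => (1 + (τ : ℂ) • (G z * C)).det)
    ?_ ?_ ?_ ?_ hs
  · simpa using key
  · have hGc : ContinuousOn G (closure U) := continuousOn_pi.2 fun i => continuousOn_pi.2 fun j =>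
      fun z hz => (hG z hz i j).continuousAt.continuousWithinAt
    have hGc' : ContinuousOn (fun p : ℝ × ℂ => G p.2) (Icc 0 1 ×ˢ closure U) :=
      hGc.comp continuousOn_snd fun p hp => hp.2
    refine Continuous.comp_continuousOn (g := fun A : Matrix κ κ ℂ => A.det)
      (continuous_id.matrix_det) ?_
    refine continuousOn_const.add (ContinuousOn.smul
      (f := fun p : ℝ × ℂ => (p.1 : ℂ)) (by fun_prop) ?_)
    exact Continuous.comp_continuousOn (g := fun A : Matrix κ κ ℂ => A * C)
      (continuous_id.matrix_mul continuous_const) hGc'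
  · intro τ _ z hz
    refine (analyticAt_det (analyticAt_one_add fun i j => ?_)).differentiableAt.differentiableWithinAt
    simp only [Matrix.smul_apply, smul_eq_mul]
    exact analyticAt_const.mul (analyticAt_matrix_mul (T := fun _ => C) (hG z (subset_closure hz))
      (fun _ _ => analyticAt_const) i j)
  · intro τ hτ z hz hdet
    obtain ⟨α, h0, h1, hm⟩ := exists_neg_one_mem_smul_fieldOfValues hC hC1 hτ hdet
    exact hF z hz α h0 h1 hm
  · intro z _
    simp

end

theorem hasStableInterareaModesIn {n : ℕ} {A : Matrix (Fin n) (Fin n) ℝ} (hA : A.IsHermitian)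
    {G : ℂ → Matrix (Fin n) (Fin n) ℂ} {S : Set ℂ}
    (hG : ∀ s ∈ S, ∀ i j, AnalyticAt ℂ (fun z => G z i j) s)
    (hdet : ∀ s ∈ S, (1 + G s * toComplex A).det ≠ 0) : HasStableInterareaModesIn hA G S := by
  have hU (s : ℂ) := analyticAt_matrix_const (toComplex (interareaBasis hA)) s
  have hUT (s : ℂ) := analyticAt_matrix_const (toComplex (interareaBasis hA))ᵀ s
  have hX (s : ℂ) := analyticAt_matrix_const
    (diagonal fun k : {i // hA.eigenvalues i ≠ 0} => (hA.eigenvalues k.1 : ℂ)) s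
  have hAc (s : ℂ) := analyticAt_matrix_const (toComplex A) s
  refine ⟨fun s hs => not_isClosedLoopMode (analyticAt_matrix_mul (analyticAt_matrix_mul
    (analyticAt_matrix_mul (hUT s) (hG s hs)) (hU s)) (hX s)) ?_, ?_⟩
  · rw [det_one_add_interareaLoop]
    exact hdet s hs
  · rintro s hs ⟨i, j, hlt⟩
    refine not_lt.2 (AnalyticAt.meromorphicOrderAt_nonneg ?_) hlt
    exact analyticAt_matrix_mul (hAc s)
      (analyticAt_inv (analyticAt_one_add (analyticAt_matrix_mul (hG s hs) (hAc s))) (hdet s hs)) i j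

end Nyquist

theorem mainTheorem3 {n : ℕ} (hn : 2 ≤ n)
    -- the network: voltage magnitudes, susceptances, phase angles at the operating point
    (V : Fin n → ℝ) (hV : ∀ i, 0 < V i)
    (b : Fin n → Fin n → ℝ) (hb : ∀ i j, b i j = b j i) (hb0 : ∀ i j, 0 ≤ b i j)
    (δ : Fin n → ℝ)
    -- the network matrix is the Laplacian matrix of a connected network
    (hLap : ∀ i j, i ≠ j → Nyquist.networkMatrix V b δ i j ≤ 0)
    (hconn : (Nyquist.networkGraph (Nyquist.networkMatrix V b δ)).Connected)
    -- the agents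
    (M : Fin n → ℝ) (hM : ∀ i, 0 ≤ M i)
    (F R : Fin n → ℂ → ℂ) (hF : ∀ i, Meromorphic (F i)) (hR : ∀ i, Meromorphic (R i))
    (hden : ∀ i, ∃ s, meromorphicOrderAt (Nyquist.agentDenominator (M i) (F i) (R i)) s ≠ ⊤)
    -- the contour
    (r : ℝ) (hr : 0 < r) (P : Finset (ℝ × ℝ))
    (havoid : ∀ ω : ℝ, ¬ Nyquist.HasPole
      (Nyquist.normalizedAgents (Nyquist.networkMatrix V b δ) M F R) (Nyquist.axisPoint r P ω))
    -- no open-loop poles inside the contour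
    (hpoles : ∀ s ∈ Nyquist.insideContour r P, ¬ Nyquist.HasPole
      (Nyquist.normalizedAgents (Nyquist.networkMatrix V b δ) M F R) s)
    -- the field of values does not encircle `-1`
    (hfield : ∀ᶠ ρ : ℝ in atTop, ∀ α : ℝ, 0 < α → α ≤ 1 →
      Nyquist.NotIncludesOrEncircles
        (fun t => α • Nyquist.fieldOfValues
          (Nyquist.normalizedAgents (Nyquist.networkMatrix V b δ) M F R
            (Nyquist.contour r P ρ t)))
        (-ρ) (ρ + Real.pi) (-1)) :
    Nyquist.HasStableInterareaModesIn
      (Nyquist.isHermitian_normalizedNetwork V δ hb)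
      (Nyquist.normalizedAgents (Nyquist.networkMatrix V b δ) M F R)
      (Nyquist.insideContour r P) := by
  have : Nontrivial (Fin n) := Fin.nontrivial_iff_two_le.2 hn
  have hsymm := Nyquist.networkMatrix_symm V δ hb
  have hrow := Nyquist.networkMatrix_row_sum V b δ
  have hdiag := Nyquist.laplacian_diag_pos hsymm hrow hLap hconn
  have han : ∀ s : ℂ, Nyquist.indentation r P s.im ≤ s.re →
      ∀ i j, AnalyticAt ℂ (fun z => Nyquist.normalizedAgents (Nyquist.networkMatrix V b δ) M F R z i j) s := by
    intro s hs
    apply Nyquist.analyticAt_normalizedAgents hdiag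
    rcases hs.eq_or_lt with he | hlt
    · have := havoid s.im
      rwa [Nyquist.axisPoint, he] at this
    · exact hpoles s hlt
  refine Nyquist.hasStableInterareaModesIn _ (fun s hs => han s (le_of_lt hs)) fun s hs => ?_
  -- The region is unbounded, so each point is treated in a half-disc large enough to contain it.
  obtain ⟨ρ, hρ, hsρ⟩ := (hfield.and (eventually_gt_atTop ‖s‖)).exists
  refine Nyquist.det_one_add_mul_ne_zero (U := Nyquist.insideContour r P ∩ Metric.ball 0 ρ)
    (Metric.isBounded_ball.subset inter_subset_right)
    (Nyquist.posSemidef_toComplex (Nyquist.posSemidef_normalizedNetwork (Nyquist.posSemidef_of_laplacian hsymm hrow hLap)))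
    ?_ (fun z hz => han z (Nyquist.closure_insideContour_inter_ball hz).1) ?_
    (subset_closure ⟨hs, mem_ball_zero_iff.2 hsρ⟩)
  · have h1 := Nyquist.posSemidef_toComplex (Nyquist.posSemidef_one_sub_normalizedNetwork hdiag
      (Nyquist.posSemidef_two_diagonal_sub_laplacian hsymm hrow hLap))
    convert h1 using 1
    ext i j
    simp [Nyquist.toComplex, Matrix.one_apply, apply_ite Complex.ofReal]
  · intro z hz α h0 h1
    obtain ⟨t, ht, rfl⟩ := Nyquist.exists_contour_eq_of_mem_frontier hz
    exact (hρ α h0 h1).1 t ht
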